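/- For a real matrix $M$ let $\|M\|_F$ be the Frobenius norm, $\|M\|_2$ the operator norm, $r(M)=\|M\|_F^2/\|M\|_2^2$ the stable rank, and, for a positive definite $M=(m_{ij})$, let $\rho(M)=(m_{ij}/\sqrt{m_{ii}m_{jj}})$ be its correlation matrix. Let $K=\sup_{p\ge 1}p^{-1/2}(\mathbb E|\xi|^p)^{1/p}$ with $\xi\sim N(0,1)$. There is an absolute constant $C>0$ such that the following holds. Let $n,m,f\ge 1$ be integers with $m\vee f\ge 2$, let $A_0\in\mathbb R^{m\times m}$ and $B_0\in\mathbb R^{f\times f}$ be positive definite with $r(A_0),\,r(B_0)\ge 4\log(m\vee f)/n$, and let $X(1),\dots,X(n)$ be i.i.d. random $f\times m$ matrices such that $\operatorname{vec}X(t)$ (the columns of $X(t)$ stacked) is centred Gaussian with covariance $A_0\otimes B_0$. Let $x(t)^1,\dots,x(t)^m$ be the columns and $y(t)^1,\dots,y(t)^f$ the rows of $X(t)$, and put $$\hat\Gamma_{ij}(A_0)=\frac{\sum_t\langle x(t)^i,x(t)^j\rangle}{\sqrt{\sum_t\|x(t)^i\|_2^2}\sqrt{\sum_t\|x(t)^j\|_2^2}},\qquad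 \hat\Gamma_{ij}(B_0)=\frac{\sum_t\langle y(t)^i,y(t)^j\rangle}{\sqrt{\sum_t\|y(t)^i\|_2^2}\sqrt{\sum_t\|y(t)^j\|_2^2}},$$ $$\tau_0=\frac{2CK^2\log^{1/2}(m\vee f)}{\sqrt n},\qquad \alpha_n=\frac{\|A_0\|_F\,\tau_0}{\operatorname{tr}(A_0)},\qquad \beta_n=\frac{\|B_0\|_F\,\tau_0}{\operatorname{tr}(B_0)}.$$ If $\alpha_n,\beta_n<1/3$, then with probability at least $1-3/(m\vee f)^2$ all of the following hold simultaneously: for all $i\ne j$, $$|\hat\Gamma_{ij}(B_0)-\rho_{ij}(B_0)|\le\frac{\alpha_n}{1-\alpha_n}+|\rho_{ij}(B_0)|\frac{\alpha_n}{1-\alpha_n}\le 3\alpha_n,$$ for all $i\ne j$, $$|\hat\Gamma_{ij}(A_0)-\rho_{ij}(A_0)|\le\frac{\beta_n}{1-\beta_n}+|\rho_{ij}(A_0)|\frac{\beta_n}{1-\beta_n}\le 3\beta_n,$$ and $$\Bigl|\frac1n\sum_{t=1}^n\|X(t)\|_F^2-\operatorname{tr}(A_0)\operatorname{tr}(B_0)\Bigr|\le\operatorname{tr}(A_0)\operatorname{tr}(B_0)\,(\alpha_n\wedge\beta_n).$$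 -/

import Mathlib

open MeasureTheory ProbabilityTheory Matrix
open scoped Kronecker

noncomputable section

/-- The Frobenius norm `(∑ᵢ ∑ⱼ aᵢⱼ²)^(1/2)` of a real matrix. -/
def frobNorm {p q : ℕ} (A : Matrix (Fin p) (Fin q) ℝ) : ℝ :=
  √(∑ i, ∑ j, A i j ^ 2)

/-- The `ℓ₂` operator norm of a square real matrix. -/
def opNorm {p : ℕ} (A : Matrix (Fin p) (Fin p) ℝ) : ℝ :=
  ‖Matrix.toEuclideanCLM (𝕜 := ℝ) A‖

/-- The stable rank `‖A‖_F² / ‖A‖₂²`. -/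
def stableRank {p : ℕ} (A : Matrix (Fin p) (Fin p) ℝ) : ℝ :=
  frobNorm A ^ 2 / opNorm A ^ 2

/-- The correlation matrix `ρ(A) = (aᵢⱼ / √(aᵢᵢ aⱼⱼ))`. -/
def corrMatrix {p : ℕ} (A : Matrix (Fin p) (Fin p) ℝ) : Matrix (Fin p) (Fin p) ℝ :=
  Matrix.of fun i j => A i j / √(A i i * A j j)

/-- `vec X`: the columns of `X` stacked into one vector of a Euclidean space. -/
def vecE {f m : ℕ} (X : Matrix (Fin f) (Fin m) ℝ) : EuclideanSpace ℝ (Fin m × Fin f) :=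
  WithLp.toLp 2 (Matrix.vec X)

/-- The `f × m` random matrix `X` follows the matrix normal law `N_{f,m}(M, A ⊗ B)`: stacking its
columns into one vector gives a Gaussian vector with mean `vec M` and covariance `A ⊗ B`. -/
def IsMatrixNormal {Ω : Type*} [MeasurableSpace Ω] {f m : ℕ}
    (X : Ω → Matrix (Fin f) (Fin m) ℝ) (M : Matrix (Fin f) (Fin m) ℝ)
    (A : Matrix (Fin m) (Fin m) ℝ) (B : Matrix (Fin f) (Fin f) ℝ) (P : Measure Ω) : Prop :=
  HasLaw (fun ω => vecE (X ω)) (multivariateGaussian (vecE M) (A ⊗ₖ B)) P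

/-- The sample correlation matrix of the columns, `Γ̂(A)`, of the replicates `X(1), …, X(n)`. -/
def sampleCorrCols {n f m : ℕ} (X : Fin n → Matrix (Fin f) (Fin m) ℝ) :
    Matrix (Fin m) (Fin m) ℝ :=
  Matrix.of fun i j =>
    (∑ t, (X t).col i ⬝ᵥ (X t).col j) /
      (√(∑ t, (X t).col i ⬝ᵥ (X t).col i) * √(∑ t, (X t).col j ⬝ᵥ (X t).col j))

/-- The sample correlation matrix of the rows, `Γ̂(B)`, of the replicates `X(1), …, X(n)`. -/
def sampleCorrRows {n f m : ℕ} (X : Fin n → Matrix (Fin f) (Fin m) ℝ) :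
    Matrix (Fin f) (Fin f) ℝ :=
  Matrix.of fun i j =>
    (∑ t, (X t).row i ⬝ᵥ (X t).row j) /
      (√(∑ t, (X t).row i ⬝ᵥ (X t).row i) * √(∑ t, (X t).row j ⬝ᵥ (X t).row j))

/-- The `ψ₂` norm `K = sup_{p ≥ 1} p^(-1/2) (𝔼|ξ|^p)^(1/p)` of a standard normal variable `ξ`. -/
def gaussianPsi2 : ℝ :=
  sSup ((fun p : ℝ => p ^ (-(1 / 2) : ℝ) * (∫ x, |x| ^ p ∂(gaussianReal 0 1)) ^ (1 / p)) ''
    Set.Ici 1)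

/-- `τ₀ = 2 C K² log^{1/2}(m ∨ f) / √n`. -/
def tauZero (C : ℝ) (n f m : ℕ) : ℝ :=
  2 * C * gaussianPsi2 ^ 2 * √(Real.log (max m f : ℕ)) / √(n : ℝ)

/-- `‖A‖_F τ / tr(A)`. With `τ = τ₀` this is `αₙ` for the matrix `A₀` and `βₙ` for `B₀`. -/
def relRate {p : ℕ} (A : Matrix (Fin p) (Fin p) ℝ) (τ : ℝ) : ℝ :=
  frobNorm A * τ / A.trace

end

/-! ### The `ψ₂` norm of a standard normal variable -/

/-! Write `G = ∑ X(t) X(t)ᵀ`. For a fixed vector `c`, the form `cᵀGc = ∑ ‖X(t)ᵀc‖²`, expanded in an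
eigenbasis of `A₀`, is a sum of squares of independent centred Gaussians with variances `(cᵀB₀c)
λₖ`. Its mean is `n tr(A₀) cᵀB₀c`, and a Chernoff bound governed by `∑ λₖ² = ‖A₀‖_F²` controls its
deviation (`measure_abs_gram_sub_le`). The stable rank hypothesis is exactly what makes the wanted
Chernoff parameter admissible.

Taking `c = eᵢ/√bᵢᵢ ± eⱼ/√bⱼⱼ` and polarizing gives every entry of `G` up to relative error `αₙ`, by
a union bound over pairs (`measure_exists_gram_deviation_le`). The rest is deterministic: entrywise
control of `G` yields the correlations (`abs_sampleCorr_sub_corrMatrix_le`), and its diagonal yields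
the trace. Columns follow by transposing `X`. The constant `K` enters only through `K > 0`, as `C`
may be taken proportional to `1/K²`. -/

lemma integrable_exp_mul_sq_gaussianReal {t : ℝ} (ht : t < 1 / 2) :
    Integrable (fun x : ℝ => Real.exp (t * x ^ 2)) (gaussianReal 0 1) := by
  rw [gaussianReal_of_var_ne_zero _ one_ne_zero,
    integrable_withDensity_iff_integrable_smul' (by fun_prop)
      (.of_forall fun _ => gaussianPDF_lt_top)]
  have h := (integrable_exp_neg_mul_sq (b := 1 / 2 - t) (by linarith)).const_mul
    (√(2 * Real.pi))⁻¹
  refine h.congr (.of_forall fun x => ?_)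
  simp only [toReal_gaussianPDF, smul_eq_mul, gaussianPDFReal, NNReal.coe_one, mul_one, sub_zero,
    mul_assoc, ← Real.exp_add]
  ring_nf

lemma integral_exp_mul_sq_gaussianReal {t : ℝ} (ht : t < 1 / 2) :
    ∫ x : ℝ, Real.exp (t * x ^ 2) ∂(gaussianReal 0 1) = (√(1 - 2 * t))⁻¹ := by
  rw [integral_gaussianReal_eq_integral_smul one_ne_zero]
  have : ∀ x : ℝ, gaussianPDFReal 0 1 x • Real.exp (t * x ^ 2) =
      (√(2 * Real.pi))⁻¹ * Real.exp (-(1 / 2 - t) * x ^ 2) := fun x => by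
    simp only [smul_eq_mul, gaussianPDFReal, NNReal.coe_one, mul_one, sub_zero, mul_assoc,
      ← Real.exp_add]
    ring_nf
  simp_rw [this]
  rw [integral_const_mul, integral_gaussian, ← Real.sqrt_inv, ← Real.sqrt_inv,
    ← Real.sqrt_mul (by positivity)]
  have h1 : (1 / 2 - t) ≠ 0 := by linarith
  have h2 : (1 - 2 * t) ≠ 0 := by linarith
  congr 1
  field_simp

/-- This is `u ≤ exp u` at `u = x²/(2p)`, raised to the power `p/2`; the scaling makes the exponent
`x²/4`, whatever `p` is. -/
lemma rpow_le_mul_exp_sq {p : ℝ} (hp : 0 < p) (x : ℝ) :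
    |x| ^ p ≤ (2 * p) ^ (p / 2) * Real.exp (1 / 4 * x ^ 2) := by
  have h : |x| ^ p = (2 * p) ^ (p / 2) * (x ^ 2 / (2 * p)) ^ (p / 2) := by
    rw [← Real.mul_rpow (by positivity) (by positivity), mul_div_cancel₀ _ (by positivity),
      ← sq_abs, ← Real.rpow_natCast, ← Real.rpow_mul (abs_nonneg x)]
    congr 1
    push_cast
    ring
  rw [h]
  refine mul_le_mul_of_nonneg_left ?_ (by positivity)
  have h2 : x ^ 2 / (2 * p) ≤ Real.exp (x ^ 2 / (2 * p)) := by
    linarith [Real.add_one_le_exp (x ^ 2 / (2 * p))]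
  calc (x ^ 2 / (2 * p)) ^ (p / 2) ≤ Real.exp (x ^ 2 / (2 * p)) ^ (p / 2) :=
        Real.rpow_le_rpow (by positivity) h2 (by positivity)
    _ = Real.exp (1 / 4 * x ^ 2) := by
        rw [← Real.exp_mul]
        congr 1
        field_simp
        ring

lemma psi2_ratio_le {p : ℝ} (hp : 1 ≤ p) :
    p ^ (-(1 / 2) : ℝ) * (∫ x, |x| ^ p ∂(gaussianReal 0 1)) ^ (1 / p) ≤ 2 * √2 := by
  have hp0 : 0 < p := by linarith
  have h2 : ∫ x, |x| ^ p ∂(gaussianReal 0 1) ≤ (2 * p) ^ (p / 2) * 2 := by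
    calc ∫ x, |x| ^ p ∂(gaussianReal 0 1)
        ≤ ∫ x, (2 * p) ^ (p / 2) * Real.exp (1 / 4 * x ^ 2) ∂(gaussianReal 0 1) :=
          integral_mono_of_nonneg (.of_forall fun x => by positivity)
            ((integrable_exp_mul_sq_gaussianReal (by norm_num)).const_mul _)
            (.of_forall fun x => rpow_le_mul_exp_sq hp0 x)
      _ ≤ (2 * p) ^ (p / 2) * 2 := by
          rw [integral_const_mul, integral_exp_mul_sq_gaussianReal (by norm_num)]
          refine mul_le_mul_of_nonneg_left ?_ (by positivity)
          refine inv_le_of_inv_le₀ (by norm_num) (Real.le_sqrt_of_sq_le (by norm_num))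
  calc p ^ (-(1 / 2) : ℝ) * (∫ x, |x| ^ p ∂(gaussianReal 0 1)) ^ (1 / p)
      ≤ p ^ (-(1 / 2) : ℝ) * ((2 * p) ^ (p / 2) * 2) ^ (1 / p) := by
        gcongr
    _ = √2 * 2 ^ (1 / p) := by
        rw [Real.mul_rpow (by positivity) (by positivity), ← Real.rpow_mul (by positivity),
          show p / 2 * (1 / p) = 1 / 2 by field_simp, Real.mul_rpow (by norm_num) hp0.le,
          Real.sqrt_eq_rpow, Real.rpow_neg hp0.le]
        have : p ^ (1 / 2 : ℝ) ≠ 0 := by positivity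
        field_simp
    _ ≤ √2 * 2 ^ (1 : ℝ) := by
        gcongr
        · norm_num
        · rw [div_le_one hp0]; exact hp
    _ = 2 * √2 := by rw [Real.rpow_one]; ring

lemma gaussianPsi2_pos : 0 < gaussianPsi2 := by
  -- Without boundedness `sSup` would take its default value `0`. Given it, the term `p = 1`, which
  -- is `𝔼|ξ| > 0`, suffices.
  have hbdd : BddAbove ((fun p : ℝ => p ^ (-(1 / 2) : ℝ) *
      (∫ x, |x| ^ p ∂(gaussianReal 0 1)) ^ (1 / p)) '' Set.Ici 1) :=
    ⟨2 * √2, by rintro _ ⟨p, hp, rfl⟩; exact psi2_ratio_le hp⟩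
  refine lt_of_lt_of_le ?_ (le_csSup hbdd ⟨1, Set.self_mem_Ici, rfl⟩)
  simp only [Real.one_rpow, one_mul, Real.rpow_one, ne_eq, one_ne_zero, not_false_eq_true, div_self]
  rw [integral_pos_iff_support_of_nonneg (fun x => abs_nonneg x)]
  · have : Function.support (fun x : ℝ => |x|) = {0}ᶜ := by ext; simp
    have hna := nullSingletonClass_gaussianReal (μ := 0) (v := 1) one_ne_zero
    rw [this, prob_compl_eq_one_sub (measurableSet_singleton 0), measure_singleton]
    simp
  · have h := (memLp_id_gaussianReal (μ := 0) (v := 1) 1).integrable (by simp)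
    exact h.abs

/-! ### Moment generating functions of Gaussian quadratic forms -/

lemma mgf_sq_gaussianReal (v : NNReal) {t : ℝ} (ht : t * v < 1 / 2) :
    mgf (fun x : ℝ => x ^ 2) (gaussianReal 0 v) t = (√(1 - 2 * (t * v)))⁻¹ := by
  have hv : gaussianReal 0 v = (gaussianReal 0 1).map (fun x => √v * x) := by
    rw [gaussianReal_map_const_mul]
    congr 1
    · simp
    · ext; simp
  rw [hv, mgf_map (by fun_prop) (by fun_prop), ← integral_exp_mul_sq_gaussianReal ht, mgf]
  congr 1 with x
  simp only [Function.comp_apply, mul_pow, Real.sq_sqrt v.coe_nonneg, mul_assoc]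

/-- After taking logarithms, `log x ≥ 1 - 1/x` at `x = 1 - 2t` leaves a remainder `4t²(1 - 4t)/(1 -
2t)`, nonnegative because `t ≤ 1/4`. Two-sided `t` serves both tails. -/
lemma inv_sqrt_one_sub_le {t : ℝ} (ht : |t| ≤ 1 / 4) :
    (√(1 - 2 * t))⁻¹ ≤ Real.exp (t + 4 * t ^ 2) := by
  obtain ⟨h1, h2⟩ := abs_le.1 ht
  have hpos : 0 < 1 - 2 * t := by linarith
  have hlog := Real.one_sub_inv_le_log_of_pos hpos
  have h3 : -(2 * t + 8 * t ^ 2) ≤ 1 - (1 - 2 * t)⁻¹ := by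
    rw [← sub_nonneg]
    have : 1 - (1 - 2 * t)⁻¹ - -(2 * t + 8 * t ^ 2) = 4 * t ^ 2 * (1 - 4 * t) / (1 - 2 * t) := by
      field_simp
      ring
    rw [this]
    have : 0 ≤ 1 - 4 * t := by linarith
    positivity
  rw [← Real.sqrt_inv, Real.sqrt_le_left (Real.exp_pos _).le, ← Real.exp_nat_mul, inv_le_comm₀ hpos
    (Real.exp_pos _), ← Real.exp_neg, ← Real.le_log_iff_exp_le hpos]
  push_cast
  linarith

section QuadraticForm

variable {Ω ι τ : Type*} [MeasurableSpace Ω] {P : Measure Ω} [Fintype ι] [Fintype τ]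

lemma mgf_sum_sq_of_hasGaussianLaw {d : ι → Ω → ℝ} {v : ι → ℝ}
    (hd : HasGaussianLaw (fun ω k => d k ω) P) (hmean : ∀ k, ∫ ω, d k ω ∂P = 0)
    (hvar : ∀ k, Var[d k; P] = v k) (hcov : ∀ k l, k ≠ l → cov[d k, d l; P] = 0)
    (hv : ∀ k, 0 ≤ v k) {t : ℝ} (ht : ∀ k, t * v k < 1 / 2) :
    mgf (fun ω => ∑ k, d k ω ^ 2) P t = ∏ k, (√(1 - 2 * (t * v k)))⁻¹ := by
  have hind := hd.iIndepFun_of_covariance_eq_zero hcov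
  have hae : ∀ k, AEMeasurable (d k) P := fun k => (hd.eval k).aemeasurable
  have hind2 := hind.comp (fun _ x => x ^ 2) (fun _ => by fun_prop)
  have h := hind2.mgf_sum₀ (t := t) (fun k => (hae k).pow_const 2) Finset.univ
  have hfun : (∑ k, (fun x : ℝ => x ^ 2) ∘ d k) = fun ω => ∑ k, d k ω ^ 2 := by
    ext ω; simp
  rw [← hfun]
  refine h.trans (Finset.prod_congr rfl fun k _ => ?_)
  have hlaw := (hd.eval k).map_eq_gaussianReal
  rw [hmean k, hvar k] at hlaw
  have hcoe : ((v k).toNNReal : ℝ) = v k := Real.coe_toNNReal _ (hv k)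
  rw [← mgf_map (X := fun x : ℝ => x ^ 2) (hae k) (by fun_prop), hlaw,
    mgf_sq_gaussianReal _ (by rw [hcoe]; exact ht k), hcoe]

lemma prod_inv_sqrt_le {v : ι → ℝ} {t : ℝ} (ht : ∀ k, |t * v k| ≤ 1 / 4) :
    ∏ k, (√(1 - 2 * (t * v k)))⁻¹ ≤ Real.exp (t * ∑ k, v k + 4 * t ^ 2 * ∑ k, v k ^ 2) := by
  refine (Finset.prod_le_prod (fun k _ => by positivity)
    fun k _ => inv_sqrt_one_sub_le (ht k)).trans_eq ?_
  rw [← Real.exp_sum, Finset.mul_sum, Finset.mul_sum, ← Finset.sum_add_distrib]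
  congr 1
  refine Finset.sum_congr rfl fun k _ => ?_
  ring

lemma mgf_sum_sum_sq_le [IsProbabilityMeasure P] {d : τ → ι → Ω → ℝ} {v : ι → ℝ}
    (hd : ∀ s, HasGaussianLaw (fun ω k => d s k ω) P) (hmean : ∀ s k, ∫ ω, d s k ω ∂P = 0)
    (hvar : ∀ s k, Var[d s k; P] = v k) (hcov : ∀ s k l, k ≠ l → cov[d s k, d s l; P] = 0)
    (hind : iIndepFun (fun s ω k => d s k ω) P)
    (hv : ∀ k, 0 ≤ v k) {t : ℝ} (ht : ∀ k, |t * v k| ≤ 1 / 4) :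
    Integrable (fun ω => Real.exp (t * ∑ s, ∑ k, d s k ω ^ 2)) P ∧
    mgf (fun ω => ∑ s, ∑ k, d s k ω ^ 2) P t ≤
      Real.exp (Fintype.card τ * (t * ∑ k, v k + 4 * t ^ 2 * ∑ k, v k ^ 2)) := by
  have hlt : ∀ k, t * v k < 1 / 2 := fun k => by linarith [(abs_le.1 (ht k)).2]
  have hae : ∀ s k, AEMeasurable (d s k) P := fun s k => ((hd s).eval k).aemeasurable
  have hind2 := hind.comp (fun _ x => ∑ k, x k ^ 2) (fun _ => by fun_prop)
  have h := hind2.mgf_sum₀ (t := t) (fun s => by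
    have : ((fun x : ι → ℝ => ∑ k, x k ^ 2) ∘ fun ω k => d s k ω) = fun ω => ∑ k, d s k ω ^ 2 := by
      ext; simp
    rw [this]
    exact Finset.aemeasurable_fun_sum _ fun k _ => (hae s k).pow_const 2) Finset.univ
  have hfun : (∑ s, (fun x : ι → ℝ => ∑ k, x k ^ 2) ∘ fun ω k => d s k ω) =
      fun ω => ∑ s, ∑ k, d s k ω ^ 2 := by
    ext ω; simp
  rw [hfun] at h
  have h' : mgf (fun ω => ∑ s, ∑ k, d s k ω ^ 2) P t =
      (∏ k, (√(1 - 2 * (t * v k)))⁻¹) ^ Fintype.card τ := by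
    rw [h]
    refine (Finset.prod_congr rfl fun s _ =>
      mgf_sum_sq_of_hasGaussianLaw (hd s) (hmean s) (hvar s) (hcov s) hv hlt).trans ?_
    simp
  have hpos : 0 < ∏ k, (√(1 - 2 * (t * v k)))⁻¹ := Finset.prod_pos fun k _ => by
    have : 0 < 1 - 2 * (t * v k) := by linarith [hlt k]
    positivity
  constructor
  -- A non-integrable exponential would have Bochner integral `0`, whereas the product formula is
  -- positive.
  · by_contra hni
    have h0 : mgf (fun ω => ∑ s, ∑ k, d s k ω ^ 2) P t = 0 := integral_undef hni
    have := pow_pos hpos (Fintype.card τ)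
    linarith
  · rw [h', Real.exp_nat_mul]
    exact pow_le_pow_left₀ hpos.le (prod_inv_sqrt_le ht) _

lemma measure_abs_sum_sum_sq_sub_le [IsProbabilityMeasure P] {d : τ → ι → Ω → ℝ} {v : ι → ℝ}
    (hd : ∀ s, HasGaussianLaw (fun ω k => d s k ω) P) (hmean : ∀ s k, ∫ ω, d s k ω ∂P = 0)
    (hvar : ∀ s k, Var[d s k; P] = v k) (hcov : ∀ s k l, k ≠ l → cov[d s k, d s l; P] = 0)
    (hind : iIndepFun (fun s ω k => d s k ω) P)
    (hv : ∀ k, 0 ≤ v k) {t : ℝ} (ht0 : 0 ≤ t) (ht : ∀ k, t * v k ≤ 1 / 4) (ε : ℝ) :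
    P.real {ω | ε < |∑ s, ∑ k, d s k ω ^ 2 - Fintype.card τ * ∑ k, v k|} ≤
      2 * Real.exp (Fintype.card τ * (4 * t ^ 2 * ∑ k, v k ^ 2) - t * ε) := by
  set V := (Fintype.card τ : ℝ) * ∑ k, v k with hV
  have habs : ∀ k, |t * v k| ≤ 1 / 4 := fun k => by
    rw [abs_of_nonneg (mul_nonneg ht0 (hv k))]; exact ht k
  have habs' : ∀ k, |-t * v k| ≤ 1 / 4 := fun k => by
    rw [neg_mul, abs_neg]; exact habs k
  obtain ⟨hi, hm⟩ := mgf_sum_sum_sq_le hd hmean hvar hcov hind hv habs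
  obtain ⟨hi', hm'⟩ := mgf_sum_sum_sq_le hd hmean hvar hcov hind hv habs'
  have h1 := measure_ge_le_exp_mul_mgf (V + ε) ht0 hi
  have h2 := measure_le_le_exp_mul_mgf (V - ε) (neg_nonpos.2 ht0) hi'
  have hsub : {ω | ε < |∑ s, ∑ k, d s k ω ^ 2 - V|} ⊆
      {ω | V + ε ≤ ∑ s, ∑ k, d s k ω ^ 2} ∪ {ω | ∑ s, ∑ k, d s k ω ^ 2 ≤ V - ε} := by
    intro ω hω
    rcases lt_abs.1 (show ε < |∑ s, ∑ k, d s k ω ^ 2 - V| from hω) with h | h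
    · exact Or.inl (show V + ε ≤ _ by linarith)
    · exact Or.inr (show _ ≤ V - ε by linarith)
  refine (measureReal_mono hsub).trans ((measureReal_union_le _ _).trans ?_)
  rw [two_mul]
  refine add_le_add (h1.trans ?_) (h2.trans ?_)
  · refine (mul_le_mul_of_nonneg_left hm (Real.exp_pos _).le).trans_eq ?_
    rw [← Real.exp_add, hV]
    ring_nf
  · refine (mul_le_mul_of_nonneg_left hm' (Real.exp_pos _).le).trans_eq ?_
    rw [← Real.exp_add, hV]
    ring_nf

end QuadraticForm

/-! ### Bilinear functionals of a matrix normal variable -/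

section MatrixNormal

variable {Ω : Type*} [MeasurableSpace Ω] {P : Measure Ω} {f m : ℕ}

lemma charFun_map_linearIsometryEquiv {E F : Type*} [NormedAddCommGroup E] [InnerProductSpace ℝ E]
    [NormedAddCommGroup F] [InnerProductSpace ℝ F] [MeasurableSpace E] [MeasurableSpace F]
    [BorelSpace E] [BorelSpace F] [SecondCountableTopology F] (μ : Measure E) (e : E ≃ₗᵢ[ℝ] F)
    (t : F) : charFun (μ.map e) t = charFun μ (e.symm t) := by
  rw [charFun_apply, charFun_apply, integral_map (by fun_prop) (by fun_prop)]
  congr 1 with x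
  rw [← e.inner_map_map x, e.apply_symm_apply]

/-- Transposition permutes the coordinates of `vec X`, an isometry that swaps the Kronecker factors;
characteristic functions identify the law. This lets one argument treat both rows and columns. -/
lemma IsMatrixNormal.transpose {X : Ω → Matrix (Fin f) (Fin m) ℝ} {M : Matrix (Fin f) (Fin m) ℝ}
    {A : Matrix (Fin m) (Fin m) ℝ} {B : Matrix (Fin f) (Fin f) ℝ}
    (hX : IsMatrixNormal X M A B P) (hA : A.PosSemidef) (hB : B.PosSemidef) :
    IsMatrixNormal (fun ω => (X ω)ᵀ) Mᵀ B A P := by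
  let e : EuclideanSpace ℝ (Fin m × Fin f) ≃ₗᵢ[ℝ] EuclideanSpace ℝ (Fin f × Fin m) :=
    LinearIsometryEquiv.piLpCongrLeft 2 ℝ ℝ (Equiv.prodComm (Fin m) (Fin f))
  have he : ∀ Y : Matrix (Fin f) (Fin m) ℝ, e (vecE Y) = vecE Yᵀ := fun Y => by
    ext ⟨i, j⟩
    simp [e, vecE, LinearIsometryEquiv.piLpCongrLeft_apply, Equiv.piCongrLeft', Matrix.vec]
  have hmap : (multivariateGaussian (vecE M) (A ⊗ₖ B)).map e =
      multivariateGaussian (vecE Mᵀ) (B ⊗ₖ A) := by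
    have := Measure.isProbabilityMeasure_map (μ := multivariateGaussian (vecE M) (A ⊗ₖ B))
      (f := e) (by fun_prop)
    refine Measure.ext_of_charFun (funext fun t => ?_)
    rw [charFun_map_linearIsometryEquiv, charFun_multivariateGaussian (hA.kronecker hB),
      charFun_multivariateGaussian (hB.kronecker hA), ← e.inner_map_map, e.apply_symm_apply, he]
    congr 4
    simp only [dotProduct, mulVec, kroneckerMap_apply]
    rw [← (Equiv.prodComm (Fin f) (Fin m)).sum_comp]
    refine Finset.sum_congr rfl fun x _ => ?_
    rw [← (Equiv.prodComm (Fin f) (Fin m)).sum_comp]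
    congr 1
    refine Finset.sum_congr rfl fun y _ => ?_
    rw [mul_comm (B _ _)]
    rfl
  refine ⟨?_, ?_⟩
  · simp_rw [← he]
    exact e.continuous.measurable.comp_aemeasurable hX.aemeasurable
  · rw [← hmap, ← hX.map_eq, AEMeasurable.map_map_of_aemeasurable (by fun_prop) hX.aemeasurable]
    simp_rw [Function.comp_def, he]

lemma dotProduct_mulVec_eq_inner_vecE (X : Matrix (Fin f) (Fin m) ℝ) (c : Fin f → ℝ)
    (e : Fin m → ℝ) : c ⬝ᵥ X *ᵥ e = inner ℝ (vecE (vecMulVec c e)) (vecE X) := by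
  rw [vecE, vecE, EuclideanSpace.inner_toLp_toLp]
  simp only [dotProduct, mulVec, Matrix.vec, vecMulVec_apply, Fintype.sum_prod_type,
    Finset.mul_sum, star_trivial]
  rw [Finset.sum_comm]
  refine Finset.sum_congr rfl fun k _ => Finset.sum_congr rfl fun i _ => ?_
  ring

variable {X : Ω → Matrix (Fin f) (Fin m) ℝ} {A : Matrix (Fin m) (Fin m) ℝ}
  {B : Matrix (Fin f) (Fin f) ℝ}

lemma IsMatrixNormal.hasGaussianLaw_dotProduct_mulVec {ι : Type*} [Fintype ι]
    (hX : IsMatrixNormal X 0 A B P) (c : Fin f → ℝ) (e : ι → Fin m → ℝ) :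
    HasGaussianLaw (fun ω k => c ⬝ᵥ X ω *ᵥ e k) P := by
  simp_rw [dotProduct_mulVec_eq_inner_vecE]
  exact (HasLaw.hasGaussianLaw hX).map_fun
    (ContinuousLinearMap.pi fun k => innerSL ℝ (vecE (vecMulVec c (e k))))

lemma IsMatrixNormal.integral_dotProduct_mulVec (hX : IsMatrixNormal X 0 A B P)
    (c : Fin f → ℝ) (e : Fin m → ℝ) : ∫ ω, c ⬝ᵥ X ω *ᵥ e ∂P = 0 := by
  simp_rw [dotProduct_mulVec_eq_inner_vecE]
  have h := hX.integral_comp (f := fun x => inner ℝ (vecE (vecMulVec c e)) x) (by fun_prop)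
  refine h.trans ?_
  rw [integral_inner (𝕜 := ℝ) (f := fun x => x) IsGaussian.integrable_id]
  simp [vecE]

/-- The functional is the inner product with `vec (c eᵀ)`, and `(A ⊗ B) vec M = vec (B M Aᵀ)` splits
the covariance into two factors. Hence distinct eigenvectors of `A` give uncorrelated, so
independent, Gaussians. -/
lemma IsMatrixNormal.covariance_dotProduct_mulVec (hX : IsMatrixNormal X 0 A B P)
    (hA : A.PosSemidef) (hB : B.PosSemidef) (c c' : Fin f → ℝ) (e e' : Fin m → ℝ) :
    cov[fun ω => c ⬝ᵥ X ω *ᵥ e, fun ω => c' ⬝ᵥ X ω *ᵥ e'; P] =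
      (c ⬝ᵥ B *ᵥ c') * (e ⬝ᵥ A *ᵥ e') := by
  have h := hX.covariance_fun_comp (f := fun x => inner ℝ (vecE (vecMulVec c e)) x)
    (g := fun x => inner ℝ (vecE (vecMulVec c' e')) x) (by fun_prop) (by fun_prop)
  simp_rw [← dotProduct_mulVec_eq_inner_vecE] at h
  rw [h, ← covarianceBilin_apply_eq_cov IsGaussian.memLp_two_id,
    covarianceBilin_multivariateGaussian (hA.kronecker hB)]
  simp only [vecE]
  rw [kronecker_mulVec_vec, vec_dotProduct_vec, transpose_vecMulVec, mul_vecMulVec,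
    vecMulVec_mul (B *ᵥ c'), vecMulVec_mul_vecMulVec, vecMul_transpose, trace_vecMulVec]
  simp

end MatrixNormal

/-! ### Concentration of the sample Gram matrix -/

section Spectral

variable {q : ℕ} {A : Matrix (Fin q) (Fin q) ℝ}

lemma frobNorm_sq {p : ℕ} (M : Matrix (Fin p) (Fin q) ℝ) : frobNorm M ^ 2 = ∑ i, ∑ j, M i j ^ 2 :=
  Real.sq_sqrt (Finset.sum_nonneg fun _ _ => Finset.sum_nonneg fun _ _ => sq_nonneg _)

lemma sum_sq_dotProduct_orthonormalBasis
    (b : OrthonormalBasis (Fin q) ℝ (EuclideanSpace ℝ (Fin q))) (w : Fin q → ℝ) :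
    ∑ k, (w ⬝ᵥ (b k).ofLp) ^ 2 = w ⬝ᵥ w := by
  have h := b.sum_sq_inner_right (WithLp.toLp 2 w)
  rw [EuclideanSpace.real_norm_sq_eq] at h
  simpa [EuclideanSpace.inner_eq_star_dotProduct, dotProduct, sq] using h

/-- Each `λₖ²` is `‖A uₖ‖²`; summing over `k` and applying Parseval to each row of `A` gives the
Frobenius norm. -/
lemma Matrix.IsHermitian.sum_sq_eigenvalues (hA : A.IsHermitian) :
    ∑ k, hA.eigenvalues k ^ 2 = frobNorm A ^ 2 := by
  have h1 : ∀ k, hA.eigenvalues k ^ 2 =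
      ∑ i, (A i ⬝ᵥ (hA.eigenvectorBasis k).ofLp) ^ 2 := fun k => by
    have h := congr_arg (fun w : Fin q → ℝ => ∑ i, w i ^ 2) (hA.mulVec_eigenvectorBasis k)
    simp only [Pi.smul_apply, smul_eq_mul, mul_pow, ← Finset.mul_sum] at h
    have hn : ∑ i, (hA.eigenvectorBasis k).ofLp i ^ 2 = 1 := by
      rw [← EuclideanSpace.real_norm_sq_eq, hA.eigenvectorBasis.orthonormal.1 k, one_pow]
    rw [hn, mul_one] at h
    exact h.symm
  simp_rw [h1]
  rw [Finset.sum_comm, frobNorm_sq]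
  refine Finset.sum_congr rfl fun i _ => ?_
  rw [sum_sq_dotProduct_orthonormalBasis]
  simp [dotProduct, sq]

lemma Matrix.IsHermitian.abs_eigenvalues_le_opNorm (hA : A.IsHermitian) (k : Fin q) :
    |hA.eigenvalues k| ≤ opNorm A := by
  have h := (Matrix.toEuclideanCLM (𝕜 := ℝ) A).le_opNorm (hA.eigenvectorBasis k)
  have h2 : Matrix.toEuclideanCLM (𝕜 := ℝ) A (hA.eigenvectorBasis k) =
      hA.eigenvalues k • hA.eigenvectorBasis k := by
    ext i
    simpa using congr_fun (hA.mulVec_eigenvectorBasis k) i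
  rw [h2, norm_smul, hA.eigenvectorBasis.orthonormal.1 k] at h
  simpa [opNorm] using h

lemma Matrix.IsHermitian.eigenvectorBasis_dotProduct_mulVec (hA : A.IsHermitian) (k l : Fin q) :
    (hA.eigenvectorBasis k).ofLp ⬝ᵥ A *ᵥ (hA.eigenvectorBasis l).ofLp =
      if k = l then hA.eigenvalues k else 0 := by
  have h := hA.eigenvectorBasis.inner_eq_ite l k
  rw [EuclideanSpace.inner_eq_star_dotProduct, star_trivial] at h
  rw [hA.mulVec_eigenvectorBasis, dotProduct_smul, h]
  by_cases hkl : k = l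
  · simp [hkl]
  · simp [hkl, Ne.symm hkl]

end Spectral

section Concentration

variable {Ω : Type*} [MeasurableSpace Ω] {P : Measure Ω} [IsProbabilityMeasure P] {n p q : ℕ}
  {X : Fin n → Ω → Matrix (Fin p) (Fin q) ℝ} {A : Matrix (Fin q) (Fin q) ℝ}
  {B : Matrix (Fin p) (Fin p) ℝ}

lemma measure_abs_gram_sub_le (hA : A.PosDef) (hB : B.PosDef)
    (hX : ∀ t, IsMatrixNormal (X t) 0 A B P) (hind : iIndepFun (fun t ω => vecE (X t ω)) P)
    (c : Fin p → ℝ) {l : ℝ} (hl0 : 0 ≤ l) (hl : l * (c ⬝ᵥ B *ᵥ c) * opNorm A ≤ 1 / 4) (ε : ℝ) :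
    P.real {ω | ε < |c ⬝ᵥ (∑ t, X t ω * (X t ω)ᵀ) *ᵥ c - n * A.trace * (c ⬝ᵥ B *ᵥ c)|} ≤
      2 * Real.exp (n * (4 * l ^ 2 * ((c ⬝ᵥ B *ᵥ c) ^ 2 * frobNorm A ^ 2)) - l * ε) := by
  have hAh := hA.isHermitian
  set s := c ⬝ᵥ B *ᵥ c with hs
  have hs0 : 0 ≤ s := by simpa using hB.posSemidef.dotProduct_mulVec_nonneg c
  have hev : ∀ k, 0 ≤ hAh.eigenvalues k := hA.posSemidef.eigenvalues_nonneg
  have hcov : ∀ t k j, cov[fun ω => c ⬝ᵥ X t ω *ᵥ (hAh.eigenvectorBasis k).ofLp,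
      fun ω => c ⬝ᵥ X t ω *ᵥ (hAh.eigenvectorBasis j).ofLp; P] =
      if k = j then s * hAh.eigenvalues k else 0 := fun t k j => by
    rw [(hX t).covariance_dotProduct_mulVec hA.posSemidef hB.posSemidef,
      hAh.eigenvectorBasis_dotProduct_mulVec]
    split_ifs <;> simp [hs]
  have hG : ∀ t, HasGaussianLaw
      (fun ω k => c ⬝ᵥ X t ω *ᵥ (hAh.eigenvectorBasis k).ofLp) P := fun t =>
    (hX t).hasGaussianLaw_dotProduct_mulVec c fun k => (hAh.eigenvectorBasis k).ofLp
  have hI : iIndepFun (fun t ω k => c ⬝ᵥ X t ω *ᵥ (hAh.eigenvectorBasis k).ofLp) P := by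
    have := hind.comp (fun _ x k => inner ℝ
      (vecE (vecMulVec c (hAh.eigenvectorBasis k).ofLp)) x) (fun _ => by fun_prop)
    simp_rw [dotProduct_mulVec_eq_inner_vecE]
    exact this
  have key := measure_abs_sum_sum_sq_sub_le (v := fun k => s * hAh.eigenvalues k) hG
    (fun t k => (hX t).integral_dotProduct_mulVec c _)
    (fun t k => by
      rw [← covariance_self ((hG t).eval k).aemeasurable, hcov, if_pos rfl])
    (fun t k j hkj => by rw [hcov, if_neg hkj]) hI
    (fun k => mul_nonneg hs0 (hev k)) hl0
    (fun k => by
      refine le_trans ?_ hl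
      rw [← mul_assoc]
      exact mul_le_mul_of_nonneg_left ((le_abs_self _).trans (hAh.abs_eigenvalues_le_opNorm k))
        (mul_nonneg hl0 hs0)) ε
  -- Parseval for `X(t)ᵀc` in the eigenbasis of `A`.
  have hsum : ∀ ω, ∑ t, ∑ k, (c ⬝ᵥ X t ω *ᵥ (hAh.eigenvectorBasis k).ofLp) ^ 2 =
      c ⬝ᵥ (∑ t, X t ω * (X t ω)ᵀ) *ᵥ c := fun ω => by
    simp_rw [dotProduct_mulVec, sum_sq_dotProduct_orthonormalBasis]
    rw [vecMul_sum, sum_dotProduct]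
    refine Finset.sum_congr rfl fun t _ => ?_
    rw [← vecMul_vecMul, ← dotProduct_mulVec (c ᵥ* X t ω), mulVec_transpose]
  have htr : A.trace = ∑ k, hAh.eigenvalues k := by simpa using hAh.trace_eq_sum_eigenvalues
  simp_rw [hsum, mul_pow, ← Finset.mul_sum, hAh.sum_sq_eigenvalues, ← htr, Fintype.card_fin] at key
  simp_rw [mul_assoc (n : ℝ) A.trace, mul_comm A.trace]
  exact key

lemma frobNorm_pos (hA : A.PosDef) (hq : 1 ≤ q) : 0 < frobNorm A := by
  have i : Fin q := ⟨0, hq⟩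
  refine Real.sqrt_pos.2 (Finset.sum_pos' (fun _ _ => Finset.sum_nonneg fun _ _ => sq_nonneg _)
    ⟨i, Finset.mem_univ _, Finset.sum_pos' (fun _ _ => sq_nonneg _)
      ⟨i, Finset.mem_univ _, pow_pos hA.diag_pos 2⟩⟩)

lemma opNorm_pos (hA : A.PosDef) (hq : 1 ≤ q) : 0 < opNorm A :=
  (abs_pos.2 (hA.eigenvalues_pos ⟨0, hq⟩).ne').trans_le
    (hA.isHermitian.abs_eigenvalues_le_opNorm _)

lemma measure_abs_gram_sub_le_of_stableRank (hn : 1 ≤ n) (hq : 1 ≤ q) (hA : A.PosDef)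
    (hB : B.PosDef) (hX : ∀ t, IsMatrixNormal (X t) 0 A B P)
    (hind : iIndepFun (fun t ω => vecE (X t ω)) P) {N : ℕ} (hN : 2 ≤ N)
    (hr : 4 * Real.log N / n ≤ stableRank A) (c : Fin p → ℝ) :
    P.real {ω | frobNorm A * (14 * √(Real.log N) / √n) * n * (c ⬝ᵥ B *ᵥ c) <
        |c ⬝ᵥ (∑ t, X t ω * (X t ω)ᵀ) *ᵥ c - n * A.trace * (c ⬝ᵥ B *ᵥ c)|} ≤
      2 * ((N : ℝ) ^ 6)⁻¹ := by
  -- The zero vector does occur later, as the difference vector when `i = j`.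
  rcases eq_or_ne c 0 with rfl | hc
  · simp
  have hs : 0 < c ⬝ᵥ B *ᵥ c := by simpa using hB.dotProduct_mulVec_pos hc
  have hF := frobNorm_pos hA hq
  have hO := opNorm_pos hA hq
  have hn0 : (0 : ℝ) < n := by exact_mod_cast hn
  have hN0 : (0 : ℝ) < N := by positivity
  have hL : 0 < Real.log N := Real.log_pos (by exact_mod_cast hN)
  -- The square root of the stable rank hypothesis; it is the condition `l s ‖A‖₂ ≤ 1/4` for the `l`
  -- chosen below.
  have hr' : 2 * √(Real.log N) * opNorm A ≤ √n * frobNorm A := by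
    refine (sq_le_sq₀ (by positivity) (by positivity)).1 ?_
    rw [mul_pow, mul_pow, mul_pow, Real.sq_sqrt hL.le, Real.sq_sqrt hn0.le]
    rw [stableRank, div_le_div_iff₀ hn0 (by positivity)] at hr
    linarith
  have hsn : 0 < √(n : ℝ) := Real.sqrt_pos.2 hn0
  have hsn2 : √(n : ℝ) ^ 2 = n := Real.sq_sqrt hn0.le
  have hsL : √(Real.log N) ^ 2 = Real.log N := Real.sq_sqrt hL.le
  set s := c ⬝ᵥ B *ᵥ c
  have key := measure_abs_gram_sub_le hA hB hX hind c
    (l := √(Real.log N) / (2 * √n * s * frobNorm A)) (by positivity) (by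
      rw [div_mul_eq_mul_div, div_mul_eq_mul_div, div_le_div_iff₀ (by positivity) (by norm_num)]
      nlinarith) (frobNorm A * (14 * √(Real.log N) / √n) * n * s)
  refine key.trans_eq ?_
  congr 1
  -- The quadratic term equals `log N` and the linear term `7 log N`; this is how `14` yields the
  -- power `N⁻⁶`.
  have : (n : ℝ) * (4 * (√(Real.log N) / (2 * √n * s * frobNorm A)) ^ 2 *
      (s ^ 2 * frobNorm A ^ 2)) - √(Real.log N) / (2 * √n * s * frobNorm A) *
      (frobNorm A * (14 * √(Real.log N) / √n) * n * s) = -(6 * Real.log N) := by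
    generalize √(n : ℝ) = b at hsn hsn2 ⊢
    generalize √(Real.log N) = a at hsL ⊢
    rw [← hsn2, ← hsL]
    field_simp
    ring
  rw [this, Real.exp_neg, ← Real.exp_log (pow_pos hN0 6), Real.log_pow]
  push_cast
  rfl

end Concentration

/-! ### From Gram matrices to correlation matrices -/

section Deterministic

variable {p : ℕ} {B G : Matrix (Fin p) (Fin p) ℝ}

/-- The `i`-th standard basis vector, scaled to have unit `B`-norm. -/
noncomputable def normalizedSingle (B : Matrix (Fin p) (Fin p) ℝ) (i : Fin p) : Fin p → ℝ :=
  Pi.single i (√(B i i))⁻¹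

lemma normalizedSingle_dotProduct_mulVec (M : Matrix (Fin p) (Fin p) ℝ) (i j : Fin p) :
    normalizedSingle B i ⬝ᵥ M *ᵥ normalizedSingle B j = M i j / (√(B i i) * √(B j j)) := by
  rw [normalizedSingle, normalizedSingle, single_dotProduct, mulVec_single]
  simp
  field_simp

lemma quadratic_add_normalizedSingle {M : Matrix (Fin p) (Fin p) ℝ} (hM : Mᵀ = M) (i j : Fin p) :
    (normalizedSingle B i + normalizedSingle B j) ⬝ᵥ
      M *ᵥ (normalizedSingle B i + normalizedSingle B j) =
      M i i / (√(B i i) * √(B i i)) + M j j / (√(B j j) * √(B j j)) +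
        2 * (M i j / (√(B i i) * √(B j j))) := by
  have hs : M j i = M i j := congr_fun (congr_fun hM i) j
  simp only [mulVec_add, add_dotProduct, dotProduct_add, normalizedSingle_dotProduct_mulVec, hs]
  ring

lemma quadratic_sub_normalizedSingle {M : Matrix (Fin p) (Fin p) ℝ} (hM : Mᵀ = M) (i j : Fin p) :
    (normalizedSingle B i - normalizedSingle B j) ⬝ᵥ
      M *ᵥ (normalizedSingle B i - normalizedSingle B j) =
      M i i / (√(B i i) * √(B i i)) + M j j / (√(B j j) * √(B j j)) -
        2 * (M i j / (√(B i i) * √(B j j))) := by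
  have hs : M j i = M i j := congr_fun (congr_fun hM i) j
  simp only [mulVec_sub, sub_dotProduct, dotProduct_sub, normalizedSingle_dotProduct_mulVec, hs]
  ring

lemma transpose_eq_of_posDef (hB : B.PosDef) : Bᵀ = B := by
  simpa [conjTranspose_eq_transpose_of_trivial] using hB.isHermitian.eq

/-- Polarization: the two forms differ by four times the normalized entry, while their `B`-values `2
+ 2ρ` and `2 - 2ρ` add up to `4`, so the rate `r` survives without loss. -/
lemma abs_sub_le_of_quadratic (hB : B.PosDef) (hG : Gᵀ = G) {T r : ℝ} (i j : Fin p)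
    (hadd : |(normalizedSingle B i + normalizedSingle B j) ⬝ᵥ
        G *ᵥ (normalizedSingle B i + normalizedSingle B j) -
        T * ((normalizedSingle B i + normalizedSingle B j) ⬝ᵥ
          B *ᵥ (normalizedSingle B i + normalizedSingle B j))| ≤
      r * ((normalizedSingle B i + normalizedSingle B j) ⬝ᵥ
          B *ᵥ (normalizedSingle B i + normalizedSingle B j)))
    (hsub : |(normalizedSingle B i - normalizedSingle B j) ⬝ᵥ
        G *ᵥ (normalizedSingle B i - normalizedSingle B j) -
        T * ((normalizedSingle B i - normalizedSingle B j) ⬝ᵥ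
          B *ᵥ (normalizedSingle B i - normalizedSingle B j))| ≤
      r * ((normalizedSingle B i - normalizedSingle B j) ⬝ᵥ
          B *ᵥ (normalizedSingle B i - normalizedSingle B j))) :
    |G i j - T * B i j| ≤ r * (√(B i i) * √(B j j)) := by
  have hBt := transpose_eq_of_posDef hB
  have hd : ∀ k, B k k / (√(B k k) * √(B k k)) = 1 := fun k => by
    rw [Real.mul_self_sqrt hB.diag_pos.le, div_self hB.diag_pos.ne']
  rw [quadratic_add_normalizedSingle hG, quadratic_add_normalizedSingle hBt, hd, hd] at hadd
  rw [quadratic_sub_normalizedSingle hG, quadratic_sub_normalizedSingle hBt, hd, hd] at hsub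
  have hi : 0 < √(B i i) := Real.sqrt_pos.2 hB.diag_pos
  have hj : 0 < √(B j j) := Real.sqrt_pos.2 hB.diag_pos
  rw [← div_le_iff₀ (by positivity), ← abs_of_pos (mul_pos hi hj), ← abs_div,
    sub_div, mul_div_assoc]
  obtain ⟨h1, h2⟩ := abs_le.1 hadd
  obtain ⟨h3, h4⟩ := abs_le.1 hsub
  exact abs_le.2 ⟨by linarith, by linarith⟩

lemma abs_corrMatrix_le_one (hB : B.PosDef) (i j : Fin p) : |corrMatrix B i j| ≤ 1 := by
  have hBt := transpose_eq_of_posDef hB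
  have hd : ∀ k, B k k / (√(B k k) * √(B k k)) = 1 := fun k => by
    rw [Real.mul_self_sqrt hB.diag_pos.le, div_self hB.diag_pos.ne']
  have h1 : 0 ≤ (normalizedSingle B i + normalizedSingle B j) ⬝ᵥ
      B *ᵥ (normalizedSingle B i + normalizedSingle B j) := by
    simpa only [star_trivial] using
      hB.posSemidef.dotProduct_mulVec_nonneg (normalizedSingle B i + normalizedSingle B j)
  have h2 : 0 ≤ (normalizedSingle B i - normalizedSingle B j) ⬝ᵥ
      B *ᵥ (normalizedSingle B i - normalizedSingle B j) := by
    simpa only [star_trivial] using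
      hB.posSemidef.dotProduct_mulVec_nonneg (normalizedSingle B i - normalizedSingle B j)
  rw [quadratic_add_normalizedSingle hBt, hd, hd] at h1
  rw [quadratic_sub_normalizedSingle hBt, hd, hd] at h2
  rw [corrMatrix, of_apply, Real.sqrt_mul hB.diag_pos.le]
  exact abs_le.2 ⟨by linarith, by linarith⟩

/-- The diagonal bounds put the denominator `D` within `(1 ± α) M`, where `M = T √(bᵢᵢ bⱼⱼ)`. Then
`|Gᵢⱼ - ρD| ≤ |Gᵢⱼ - ρM| + |ρ| |M - D|`, and dividing by `D ≥ (1 - α) M` finishes. -/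
lemma abs_sampleCorr_sub_corrMatrix_le (hB : B.PosDef) {T α : ℝ} (hT : 0 < T) (hα0 : 0 ≤ α)
    (hα : α < 1) (hG : ∀ i j, |G i j - T * B i j| ≤ α * T * (√(B i i) * √(B j j)))
    (i j : Fin p) :
    |G i j / (√(G i i) * √(G j j)) - corrMatrix B i j| ≤
      α / (1 - α) + |corrMatrix B i j| * (α / (1 - α)) := by
  have hlo : ∀ k, √((1 - α) * T) * √(B k k) ≤ √(G k k) := fun k => by
    rw [← Real.sqrt_mul (mul_nonneg (by linarith) hT.le)]
    refine Real.sqrt_le_sqrt ?_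
    have := (abs_le.1 (hG k k)).1
    rw [Real.mul_self_sqrt hB.diag_pos.le] at this
    linarith
  have hhi : ∀ k, √(G k k) ≤ √((1 + α) * T) * √(B k k) := fun k => by
    rw [← Real.sqrt_mul (mul_nonneg (by linarith) hT.le)]
    refine Real.sqrt_le_sqrt ?_
    have := (abs_le.1 (hG k k)).2
    rw [Real.mul_self_sqrt hB.diag_pos.le] at this
    linarith
  have hi : 0 < √(B i i) := Real.sqrt_pos.2 hB.diag_pos
  have hj : 0 < √(B j j) := Real.sqrt_pos.2 hB.diag_pos
  have hα1 : 0 < 1 - α := by linarith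
  set M := T * (√(B i i) * √(B j j)) with hM
  have hM0 : 0 < M := by positivity
  set D := √(G i i) * √(G j j) with hD
  have hD1 : (1 - α) * M ≤ D := by
    refine le_trans (le_of_eq ?_) (mul_le_mul (hlo i) (hlo j) (by positivity) (by positivity))
    rw [mul_mul_mul_comm, Real.mul_self_sqrt (by positivity), hM, mul_assoc]
  have hD2 : D ≤ (1 + α) * M := by
    refine (mul_le_mul (hhi i) (hhi j) (by positivity) (by positivity)).trans (le_of_eq ?_)
    rw [mul_mul_mul_comm, Real.mul_self_sqrt (by positivity), hM, mul_assoc]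
  have hD0 : 0 < D := lt_of_lt_of_le (by positivity) hD1
  have hρ : corrMatrix B i j * M = T * B i j := by
    rw [corrMatrix, of_apply, Real.sqrt_mul hB.diag_pos.le, hM]
    field_simp
  set ρ := corrMatrix B i j
  have hnum : |G i j - ρ * D| ≤ (α + |ρ| * α) * M := by
    have h1 : |G i j - ρ * M| ≤ α * M := by
      rw [hρ, hM, ← mul_assoc]
      exact hG i j
    have h2 : |ρ * (M - D)| ≤ |ρ| * (α * M) := by
      rw [abs_mul]
      exact mul_le_mul_of_nonneg_left (abs_le.2 ⟨by linarith, by linarith⟩) (abs_nonneg _)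
    have h3 := abs_add_le (G i j - ρ * M) (ρ * (M - D))
    rw [show G i j - ρ * M + ρ * (M - D) = G i j - ρ * D by ring] at h3
    linarith
  rw [div_sub' hD0.ne', abs_div, abs_of_pos hD0, mul_comm D, div_le_iff₀ hD0]
  calc |G i j - ρ * D| ≤ (α + |ρ| * α) * M := hnum
    _ = (α / (1 - α) + |ρ| * (α / (1 - α))) * ((1 - α) * M) := by field_simp
    _ ≤ _ := mul_le_mul_of_nonneg_left hD1 (by positivity)

lemma rate_le_three_mul {α ρ : ℝ} (hα0 : 0 ≤ α) (hα : α < 1 / 3) (hρ : |ρ| ≤ 1) :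
    α / (1 - α) + |ρ| * (α / (1 - α)) ≤ 3 * α := by
  have h : α / (1 - α) ≤ 3 / 2 * α := by
    rw [div_le_iff₀ (by linarith)]
    nlinarith
  have h0 : 0 ≤ α / (1 - α) := div_nonneg hα0 (by linarith)
  nlinarith

lemma abs_trace_sub_le {T α : ℝ} (hB : B.PosDef)
    (hG : ∀ i j, |G i j - T * B i j| ≤ α * T * (√(B i i) * √(B j j))) :
    |G.trace - T * B.trace| ≤ α * T * B.trace := by
  rw [trace, trace, Finset.mul_sum, Finset.mul_sum, ← Finset.sum_sub_distrib]
  refine (Finset.abs_sum_le_sum_abs _ _).trans (Finset.sum_le_sum fun i _ => ?_)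
  have := hG i i
  rwa [Real.mul_self_sqrt hB.diag_pos.le] at this

end Deterministic

/-! ### Gram matrix identities. -/

section GramMatrix

variable {n p q : ℕ} (X : Fin n → Matrix (Fin p) (Fin q) ℝ)

lemma gram_transpose : (∑ t, X t * (X t)ᵀ)ᵀ = ∑ t, X t * (X t)ᵀ := by
  simp [transpose_sum]

lemma sampleCorrRows_eq (i j : Fin p) : sampleCorrRows X i j =
    (∑ t, X t * (X t)ᵀ) i j /
      (√((∑ t, X t * (X t)ᵀ) i i) * √((∑ t, X t * (X t)ᵀ) j j)) := by
  simp only [Matrix.sum_apply]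
  rfl

lemma sampleCorrCols_eq (i j : Fin q) :
    sampleCorrCols X i j = sampleCorrRows (fun t => (X t)ᵀ) i j := rfl

lemma trace_gram : (∑ t, X t * (X t)ᵀ).trace = ∑ t, frobNorm (X t) ^ 2 := by
  rw [trace_sum]
  refine Finset.sum_congr rfl fun t _ => ?_
  rw [frobNorm_sq]
  simp [trace, mul_apply, sq]

lemma frobNorm_transpose (M : Matrix (Fin p) (Fin q) ℝ) : frobNorm Mᵀ = frobNorm M := by
  rw [frobNorm, Finset.sum_comm]
  rfl

end GramMatrix

/-! ### Uniform control of all Gram entries. -/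

section UnionBound

variable {Ω : Type*} [MeasurableSpace Ω] {P : Measure Ω} [IsProbabilityMeasure P] {n p q : ℕ}
  {X : Fin n → Ω → Matrix (Fin p) (Fin q) ℝ} {A : Matrix (Fin q) (Fin q) ℝ}
  {B : Matrix (Fin p) (Fin p) ℝ}

lemma measure_exists_gram_deviation_le (hn : 1 ≤ n) (hq : 1 ≤ q) (hA : A.PosDef)
    (hB : B.PosDef) (hX : ∀ t, IsMatrixNormal (X t) 0 A B P)
    (hind : iIndepFun (fun t ω => vecE (X t ω)) P) {N : ℕ} (hN : 2 ≤ N) (hp : p ≤ N)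
    (hr : 4 * Real.log N / n ≤ stableRank A) :
    P.real {ω | ∀ i j, |(∑ t, X t ω * (X t ω)ᵀ) i j - n * A.trace * B i j| ≤
      frobNorm A * (14 * √(Real.log N) / √n) * n * (√(B i i) * √(B j j))}ᶜ ≤
      1 / (N : ℝ) ^ 2 := by
  let bad (c : Fin p → ℝ) : Set Ω :=
    {ω | frobNorm A * (14 * √(Real.log N) / √n) * n * (c ⬝ᵥ B *ᵥ c) <
        |c ⬝ᵥ (∑ t, X t ω * (X t ω)ᵀ) *ᵥ c - n * A.trace * (c ⬝ᵥ B *ᵥ c)|}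
  have hbad : ∀ c, P.real (bad c) ≤ 2 * ((N : ℝ) ^ 6)⁻¹ :=
    measure_abs_gram_sub_le_of_stableRank hn hq hA hB hX hind hN hr
  let badPair (x : Fin p × Fin p) : Set Ω :=
    bad (normalizedSingle B x.1 + normalizedSingle B x.2) ∪
      bad (normalizedSingle B x.1 - normalizedSingle B x.2)
  have hpair : ∀ x, P.real (badPair x) ≤ 4 * ((N : ℝ) ^ 6)⁻¹ := fun x =>
    (measureReal_union_le _ _).trans (by
      linarith [hbad (normalizedSingle B x.1 + normalizedSingle B x.2),
        hbad (normalizedSingle B x.1 - normalizedSingle B x.2)])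
  have hsub : {ω | ∀ i j, |(∑ t, X t ω * (X t ω)ᵀ) i j - n * A.trace * B i j| ≤
      frobNorm A * (14 * √(Real.log N) / √n) * n * (√(B i i) * √(B j j))}ᶜ ⊆
      ⋃ x, badPair x := by
    intro ω hω
    by_contra hnot
    refine hω fun i j => ?_
    have h : ω ∉ badPair (i, j) := fun h => hnot (Set.mem_iUnion.2 ⟨_, h⟩)
    exact abs_sub_le_of_quadratic hB (gram_transpose fun t => X t ω) i j
      (not_lt.1 fun h' => h (Or.inl h')) (not_lt.1 fun h' => h (Or.inr h'))
  have hN' : (2 : ℝ) ≤ N := by exact_mod_cast hN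
  have hp' : (p : ℝ) ≤ N := by exact_mod_cast hp
  calc _ ≤ P.real (⋃ x, badPair x) := measureReal_mono hsub
    _ ≤ ∑ x, P.real (badPair x) := measureReal_iUnion_fintype_le _
    _ ≤ ∑ x : Fin p × Fin p, 4 * ((N : ℝ) ^ 6)⁻¹ := Finset.sum_le_sum fun x _ => hpair x
    _ = p ^ 2 * (4 * ((N : ℝ) ^ 6)⁻¹) := by simp [sq]
    -- The factor `4` (two tails, two signs) is absorbed by `N² ≥ 4`.
    _ ≤ N ^ 2 * ((N : ℝ) ^ 2 * ((N : ℝ) ^ 6)⁻¹) := by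
        gcongr
        nlinarith
    _ = 1 / (N : ℝ) ^ 2 := by
        field_simp

end UnionBound

theorem theorem4 :
    ∃ C : ℝ, 0 < C ∧
      ∀ (Ω : Type*) [MeasurableSpace Ω] (P : Measure Ω) [IsProbabilityMeasure P]
        (n f m : ℕ) (A₀ : Matrix (Fin m) (Fin m) ℝ) (B₀ : Matrix (Fin f) (Fin f) ℝ)
        (X : Fin n → Ω → Matrix (Fin f) (Fin m) ℝ) (α β : ℝ),
        1 ≤ n → 1 ≤ f → 1 ≤ m → 2 ≤ max m f →
        A₀.PosDef → B₀.PosDef →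
        4 * Real.log (max m f : ℕ) / n ≤ stableRank A₀ →
        4 * Real.log (max m f : ℕ) / n ≤ stableRank B₀ →
        (∀ t, IsMatrixNormal (X t) 0 A₀ B₀ P) →
        iIndepFun (fun t ω => vecE (X t ω)) P →
        α = relRate A₀ (tauZero C n f m) →
        β = relRate B₀ (tauZero C n f m) →
        α < 1 / 3 → β < 1 / 3 →
        ENNReal.ofReal (1 - 3 / ((max m f : ℕ) : ℝ) ^ 2) ≤
          P {ω |
            (∀ i j : Fin f, i ≠ j →
              |sampleCorrRows (fun t => X t ω) i j - corrMatrix B₀ i j| ≤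
                  α / (1 - α) + |corrMatrix B₀ i j| * (α / (1 - α)) ∧
              α / (1 - α) + |corrMatrix B₀ i j| * (α / (1 - α)) ≤ 3 * α) ∧
            (∀ i j : Fin m, i ≠ j →
              |sampleCorrCols (fun t => X t ω) i j - corrMatrix A₀ i j| ≤
                  β / (1 - β) + |corrMatrix A₀ i j| * (β / (1 - β)) ∧
              β / (1 - β) + |corrMatrix A₀ i j| * (β / (1 - β)) ≤ 3 * β) ∧
            |1 / (n : ℝ) * ∑ t, frobNorm (X t ω) ^ 2 - A₀.trace * B₀.trace| ≤
              A₀.trace * B₀.trace * min α β} := by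
  have hK := gaussianPsi2_pos
  -- Chosen so that `τ₀ = 14 √(log N) / √n`.
  refine ⟨7 / gaussianPsi2 ^ 2, by positivity, ?_⟩
  intro Ω _ P _ n f m A B X α β hn hf hm hN hA hB hrA hrB hX hind hα hβ hα3 hβ3
  set N := max m f with hNdef
  have hn0 : (0 : ℝ) < n := by exact_mod_cast hn
  have hτ : tauZero (7 / gaussianPsi2 ^ 2) n f m = 14 * √(Real.log N) / √n := by
    rw [tauZero, ← hNdef]
    field_simp
    ring
  rw [relRate, hτ] at hα hβ
  have htrA : 0 < A.trace := by
    have : Nonempty (Fin m) := ⟨⟨0, hm⟩⟩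
    exact hA.trace_pos
  have htrB : 0 < B.trace := by
    have : Nonempty (Fin f) := ⟨⟨0, hf⟩⟩
    exact hB.trace_pos
  have hFA := frobNorm_pos hA hm
  have hFB := frobNorm_pos hB hf
  have hα0 : 0 ≤ α := by rw [hα]; positivity
  have hβ0 : 0 ≤ β := by rw [hβ]; positivity
  have hrowRate : frobNorm A * (14 * √(Real.log N) / √n) * n = α * (n * A.trace) := by
    rw [hα]; field_simp
  have hcolRate : frobNorm B * (14 * √(Real.log N) / √n) * n = β * (n * B.trace) := by
    rw [hβ]; field_simp
  have hindT : iIndepFun (fun t ω => vecE (X t ω)ᵀ) P := by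
    have := hind.comp (fun _ x => WithLp.toLp 2 (x.ofLp ∘ Prod.swap)) fun _ => by
      refine (WithLp.measurable_toLp _ _).comp ?_
      exact measurable_pi_lambda _ fun i => by fun_prop
    exact this
  have hrows := measure_exists_gram_deviation_le hn hm hA hB hX hind hN (le_max_right _ _) hrA
  have hcols := measure_exists_gram_deviation_le (X := fun t ω => (X t ω)ᵀ) hn hf hB hA
    (fun t => by simpa using (hX t).transpose hA.posSemidef hB.posSemidef) hindT hN
    (le_max_left _ _) hrB
  rw [hrowRate] at hrows
  rw [hcolRate] at hcols
  set R := {ω | ∀ i j, |(∑ t, X t ω * (X t ω)ᵀ) i j - n * A.trace * B i j| ≤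
      α * (n * A.trace) * (√(B i i) * √(B j j))}
  set S := {ω | ∀ i j, |(∑ t, (X t ω)ᵀ * (X t ω)ᵀᵀ) i j - n * B.trace * A i j| ≤
      β * (n * B.trace) * (√(A i i) * √(A j j))}
  -- The failure probability is in fact at most `2/N²`. Only subadditivity is used, so `R` and `S`
  -- need not be shown measurable.
  have hRS : 1 - 3 / (N : ℝ) ^ 2 ≤ P.real (R ∩ S) := by
    have h1 : P.real (R ∩ S)ᶜ ≤ P.real Rᶜ + P.real Sᶜ := by
      rw [Set.compl_inter]; exact measureReal_union_le _ _
    have h2 := measureReal_union_le (μ := P) (R ∩ S) (R ∩ S)ᶜ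
    rw [Set.union_compl_self, probReal_univ] at h2
    have h3 : (0 : ℝ) ≤ 1 / (N : ℝ) ^ 2 := by positivity
    have h4 : 3 / (N : ℝ) ^ 2 = 3 * (1 / (N : ℝ) ^ 2) := by ring
    linarith
  refine (ENNReal.ofReal_le_of_le_toReal hRS).trans (measure_mono ?_)
  rintro ω ⟨hR, hS⟩
  refine ⟨fun i j _ => ⟨?_, rate_le_three_mul hα0 hα3 (abs_corrMatrix_le_one hB i j)⟩,
    fun i j _ => ⟨?_, rate_le_three_mul hβ0 hβ3 (abs_corrMatrix_le_one hA i j)⟩, ?_⟩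
  · rw [sampleCorrRows_eq]
    exact abs_sampleCorr_sub_corrMatrix_le hB (by positivity) hα0 (by linarith) hR i j
  · rw [sampleCorrCols_eq, sampleCorrRows_eq]
    exact abs_sampleCorr_sub_corrMatrix_le hA (by positivity) hβ0 (by linarith) hS i j
  -- Both Gram matrices have trace `∑ ‖X(t)‖_F²`, so rows give the rate `α`, columns give `β`, and
  -- the minimum holds.
  · have h1 := abs_trace_sub_le hB hR
    have h2 := abs_trace_sub_le hA hS
    rw [trace_gram fun t => X t ω] at h1
    rw [trace_gram fun t => (X t ω)ᵀ] at h2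
    simp_rw [frobNorm_transpose] at h2
    rw [mul_min_of_nonneg _ _ (by positivity), show
      1 / (n : ℝ) * ∑ t, frobNorm (X t ω) ^ 2 - A.trace * B.trace =
        (∑ t, frobNorm (X t ω) ^ 2 - n * A.trace * B.trace) / n by field_simp,
      abs_div, abs_of_pos hn0, div_le_iff₀ hn0]
    rw [show n * B.trace * A.trace = n * A.trace * B.trace by ring] at h2
    rw [min_mul_of_nonneg _ _ hn0.le]
    exact le_min (h1.trans_eq (by ring)) (h2.trans_eq (by ring))
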